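/- Let $f:\mathbb{R}^d\to\mathbb{R}$ be locally Lipschitz. Its generalized gradient at $x$ is $$\partial f(x)=\operatorname{co}\Big\{\lim_{i\to\infty}\nabla f(x_i)\ :\ x_i\to x,\ f \text{ differentiable at } x_i\Big\},$$ and the critical points of $f$ are the points $x$ with $0\in\partial f(x)$. Assume that $f$ is regular, that is, for all $x,v\in\mathbb{R}^d$ the right directional derivative $f'(x;v)=\lim_{h\to0^+}\frac{f(x+hv)-f(x)}{h}$ exists and equals the generalized directional derivative $f^\circ(x;v)=\limsup_{y\to x,\,h\to0^+}\frac{f(y+hv)-f(y)}{h}$. Let $X(x)=-\operatorname{Ln}(\partial f)(x)$, where $\operatorname{Ln}(\partial f)(x)$ is the element of least Euclidean norm of $\partial f(x)$, and consider the nonsmooth gradient flow $\dot x=X(x)$ with solutions in the sense of Filippov: a solution is a map $x$ defined on an interval $I=[0,T]$, $[0,T)$ (with $0<T<\infty$) or $[0,\infty)$, absolutely continuous on every compact interval $[0,b]\subseteq I$, such that $\dot x(t)\in F[X](x(t))$ for almost every $t\in I$, where $$F[X](x)=\bigcap_{\delta>0}\ \bigcap_{\mu(S)=0}\overline{\operatorname{co}}\,\big\{X(B(x,\delta)\setminus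 S)\big\}$$ ($\mu$ is Lebesgue measure, $B(x,\delta)$ the open ball, $\overline{\operatorname{co}}$ the closed convex hull). A solution is maximal if it is not a proper truncation of another solution. Then: (a) Every strict (local) minimizer $x_e$ of $f$ is a strongly stable equilibrium of the flow: $X(x_e)=0$, $0\in F[X](x_e)$, and for every $\varepsilon>0$ there is $\delta>0$ such that every solution $x$ with $\|x(0)-x_e\|<\delta$ satisfies $\|x(t)-x_e\|<\varepsilon$ for all $t$ in its interval of definition, and is defined on $[0,\infty)$ if it is maximal. (b) If moreover every sublevel set $\{y: f(y)\le f(x)\}$, $x\in\mathbb{R}^d$, is bounded, then every maximal solution is defined on $[0,\infty)$ and converges to the set of critical points of $f$: the distance from $x(t)$ to $\{y: 0\in\partial f(y)\}$, which is a nonempty set, tends to $0$ as $t\to\infty$. -/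

import Mathlib

open Filter Topology MeasureTheory

/-- The generalized directional derivative `f°(x; v)`: the upper limit of the difference
quotients `(f (y + h v) - f y) / h` as `y → x` and `h → 0⁺`. -/
noncomputable def genDirDeriv {d : ℕ} (f : EuclideanSpace ℝ (Fin d) → ℝ)
    (x v : EuclideanSpace ℝ (Fin d)) : ℝ :=
  limsup (fun p : EuclideanSpace ℝ (Fin d) × ℝ => (f (p.1 + p.2 • v) - f p.1) / p.2)
    (𝓝 x ×ˢ 𝓝[>] (0 : ℝ))

/-- `f` is regular at `x`: for every `v` the right directional derivative of `f` at `x` in the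
direction `v` exists and equals the generalized directional derivative. -/
def IsRegularFunctionAt {d : ℕ} (f : EuclideanSpace ℝ (Fin d) → ℝ)
    (x : EuclideanSpace ℝ (Fin d)) : Prop :=
  ∀ v : EuclideanSpace ℝ (Fin d),
    Tendsto (fun h : ℝ => (f (x + h • v) - f x) / h) (𝓝[>] (0 : ℝ)) (𝓝 (genDirDeriv f x v))

/-- The generalized gradient `∂f(x)`: the convex hull of all limits of gradients of `f` along
sequences of points of differentiability that converge to `x`. -/
def generalizedGradient {d : ℕ} (f : EuclideanSpace ℝ (Fin d) → ℝ)
    (x : EuclideanSpace ℝ (Fin d)) : Set (EuclideanSpace ℝ (Fin d)) :=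
  convexHull ℝ {ζ | ∃ u : ℕ → EuclideanSpace ℝ (Fin d),
    Tendsto u atTop (𝓝 x) ∧ (∀ i, DifferentiableAt ℝ f (u i)) ∧
      Tendsto (fun i => gradient f (u i)) atTop (𝓝 ζ)}

/-- The critical points of `f`. -/
def criticalSet {d : ℕ} (f : EuclideanSpace ℝ (Fin d) → ℝ) : Set (EuclideanSpace ℝ (Fin d)) :=
  {x | 0 ∈ generalizedGradient f x}

/-- `Ln(S)`: the set of least-norm elements of the closure of `S`. -/
def leastNormSet {d : ℕ} (S : Set (EuclideanSpace ℝ (Fin d))) :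
    Set (EuclideanSpace ℝ (Fin d)) :=
  {v | v ∈ closure S ∧ ∀ w ∈ closure S, ‖v‖ ≤ ‖w‖}

open Classical in
/-- The least-norm element of the closure of `S`. For nonempty convex `S` it is the only element
of `leastNormSet S`, see `leastNormSet_eq_singleton`; the value `0` is used only when there
is no least-norm element. -/
noncomputable def leastNorm {d : ℕ} (S : Set (EuclideanSpace ℝ (Fin d))) :
    EuclideanSpace ℝ (Fin d) :=
  if h : (leastNormSet S).Nonempty then h.some else 0

theorem leastNormSet_eq_singleton {d : ℕ} {S : Set (EuclideanSpace ℝ (Fin d))}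
    (hne : S.Nonempty) (hS : Convex ℝ S) : leastNormSet S = {leastNorm S} := by
  have hex : (leastNormSet S).Nonempty := by
    obtain ⟨v, hv, hmin⟩ := isClosed_closure.exists_infDist_eq_dist hne.closure
      (0 : EuclideanSpace ℝ (Fin d))
    refine ⟨v, hv, fun w hw => ?_⟩
    have h1 := Metric.infDist_le_dist_of_mem (x := (0 : EuclideanSpace ℝ (Fin d))) hw
    rw [hmin] at h1
    simpa using h1
  have hmem : leastNorm S ∈ leastNormSet S := by
    unfold leastNorm
    rw [dif_pos hex]
    exact hex.some_mem
  refine Set.Subset.antisymm (fun v hv => ?_) (Set.singleton_subset_iff.2 hmem)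
  set u := leastNorm S
  have hc : Convex ℝ (closure S) := hS.closure
  have hmid : (1 / 2 : ℝ) • v + (1 / 2 : ℝ) • u ∈ closure S :=
    hc hv.1 hmem.1 (by norm_num) (by norm_num) (by norm_num)
  have h1 : ‖v‖ = ‖u‖ := le_antisymm (hv.2 _ hmem.1) (hmem.2 _ hv.1)
  have h2 : ‖v‖ ≤ ‖v + u‖ / 2 := by
    have := hv.2 _ hmid
    rw [← smul_add, norm_smul] at this
    norm_num at this
    linarith
  have h3 := parallelogram_law_with_norm ℝ v u
  have h4 : ‖v - u‖ = 0 := by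
    have : ‖v - u‖ * ‖v - u‖ ≤ 0 := by
      rw [h1] at h3 h2
      nlinarith [norm_nonneg u]
    nlinarith [norm_nonneg (v - u)]
  exact sub_eq_zero.1 (norm_eq_zero.1 h4)

/-- The vector field `x ↦ -Ln(∂f(x))` of the nonsmooth gradient flow of `f`. -/
noncomputable def nonsmoothGradientField {d : ℕ} (f : EuclideanSpace ℝ (Fin d) → ℝ)
    (x : EuclideanSpace ℝ (Fin d)) : EuclideanSpace ℝ (Fin d) :=
  -leastNorm (generalizedGradient f x)

/-- The Filippov set-valued map `F[X]`: the intersection, over all `δ > 0` and all Lebesgue-null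
sets `S`, of the closed convex hulls of `X (B(x, δ) \ S)`. -/
def filippovMap {d : ℕ} (X : EuclideanSpace ℝ (Fin d) → EuclideanSpace ℝ (Fin d))
    (x : EuclideanSpace ℝ (Fin d)) : Set (EuclideanSpace ℝ (Fin d)) :=
  ⋂ (δ : ℝ) (_ : 0 < δ) (S : Set (EuclideanSpace ℝ (Fin d))) (_ : volume S = 0),
    closure (convexHull ℝ (X '' (Metric.ball x δ \ S)))

/-- `x` solves the differential inclusion `x' ∈ F(x)` on `I`, a nondegenerate interval with
smallest element `0` (so `I` is `[0, T]`, `[0, T)` or `[0, ∞)`): it is absolutely continuous on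
every `[0, b]` contained in `I`, and `x'(t)` exists and lies in `F (x t)` for almost all `t` in
`I`. Values of `x` outside `I` play no role. -/
structure IsInclusionSolution {d : ℕ}
    (F : EuclideanSpace ℝ (Fin d) → Set (EuclideanSpace ℝ (Fin d)))
    (I : Set ℝ) (x : ℝ → EuclideanSpace ℝ (Fin d)) : Prop where
  isLeast_zero : IsLeast I 0
  ordConnected : I.OrdConnected
  nontrivial : I.Nontrivial
  absolutelyContinuous : ∀ b ∈ I, AbsolutelyContinuousOnInterval x 0 b
  deriv_mem : ∀ᵐ t ∂(volume.restrict I), ∃ v ∈ F (x t), HasDerivAt x v t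

/-- A solution is maximal if it is not a proper truncation of another solution. -/
def IsMaximalInclusionSolution {d : ℕ}
    (F : EuclideanSpace ℝ (Fin d) → Set (EuclideanSpace ℝ (Fin d)))
    (I : Set ℝ) (x : ℝ → EuclideanSpace ℝ (Fin d)) : Prop :=
  IsInclusionSolution F I x ∧
    ∀ (J : Set ℝ) (y : ℝ → EuclideanSpace ℝ (Fin d)),
      IsInclusionSolution F J y → I ⊆ J → Set.EqOn x y I → J = I

/-- `xe` is a strongly stable equilibrium of the differential inclusion `x' ∈ F(x)`: it is an
equilibrium, and for every `ε > 0` there is `δ > 0` such that all solutions starting within `δ`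
of `xe` stay within `ε` of `xe` for as long as they are defined, the maximal ones being defined
for all `t ≥ 0`. -/
def IsStronglyStableEquilibrium {d : ℕ}
    (F : EuclideanSpace ℝ (Fin d) → Set (EuclideanSpace ℝ (Fin d)))
    (xe : EuclideanSpace ℝ (Fin d)) : Prop :=
  0 ∈ F xe ∧
    ∀ ε : ℝ, 0 < ε → ∃ δ : ℝ, 0 < δ ∧
      ∀ (I : Set ℝ) (x : ℝ → EuclideanSpace ℝ (Fin d)),
        IsInclusionSolution F I x → dist (x 0) xe < δ →
          (∀ t ∈ I, dist (x t) xe < ε) ∧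
            (IsMaximalInclusionSolution F I x → I = Set.Ici 0)

/-!
The function `f` decreases along every solution of the nonsmooth gradient flow, and this is what
both claims rest on.

By upper semicontinuity of `∂f`, the Filippov map of `-Ln(∂f)` is contained in `-∂f`
(`LocallyLipschitz.neg_mem_closure_generalizedGradient`). Every `ζ ∈ ∂f(x)` satisfies
`⟪ζ, v⟫ ≤ f°(x; v)`, so for a regular `f` and a curve `x` with velocity `v` the right derivative
`f°(x; v)` of `f ∘ x` is at least `⟪ζ, v⟫` and the left derivative `-f°(x; -v)` is at most `⟪ζ, v⟫`.
Where `f ∘ x` is differentiable, its derivative is therefore `⟪ζ, v⟫` for every `ζ ∈ ∂f(x)`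
(`LocallyLipschitz.deriv_comp_eq_inner`). The choice `ζ = -v` gives the derivative `-‖v‖ ^ 2` along
solutions (`LocallyLipschitz.sub_le_of_isInclusionSolution`).

Stability is then Lyapunov's argument, and convergence to the critical set is LaSalle's: away from
critical points the elements of `∂f`, hence the velocities, are bounded below in norm. That the
minimizer is an equilibrium of the inclusion uses that `-Ln(∂f) = -∇f` almost everywhere for a
regular `f`, together with Fubini's theorem: if a direction separated `0` from almost all values of
the field near the minimizer, `f` would decrease along it (`LocallyLipschitz.zero_mem_filippovMap`).

Maximal solutions that stay in a compact set are global because Filippov solutions exist locally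
(`exists_filippov_solution`). Such a solution is obtained by mollifying the field, solving the
smooth equations, and taking a pointwise limit along an ultrafilter. Averages of the field lie in
the closed convex sets that define the Filippov map, hence so do slopes over short times, hence so do
the derivatives of the limit; neither uniform nor weak convergence is needed.
-/

/-! ### Absolutely continuous curves -/

theorem LipschitzOnWith.comp_absolutelyContinuousOnInterval {X Y : Type*} [PseudoMetricSpace X]
    [PseudoMetricSpace Y] {g : X → Y} {x : ℝ → X} {s : Set X} {K : NNReal} {a b : ℝ}
    (hg : LipschitzOnWith K g s) (hx : AbsolutelyContinuousOnInterval x a b)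
    (hs : Set.MapsTo x (Set.uIcc a b) s) : AbsolutelyContinuousOnInterval (g ∘ x) a b := by
  rw [absolutelyContinuousOnInterval_iff] at hx ⊢
  intro ε hε
  obtain ⟨δ, hδ, h⟩ := hx (ε / (K + 1)) (by positivity)
  refine ⟨δ, hδ, fun E hE hlt => ?_⟩
  have h1 := h E hE hlt
  calc ∑ i ∈ Finset.range E.1, dist ((g ∘ x) (E.2 i).1) ((g ∘ x) (E.2 i).2)
      ≤ ∑ i ∈ Finset.range E.1, K * dist (x (E.2 i).1) (x (E.2 i).2) :=
        Finset.sum_le_sum fun i hi =>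
          hg.dist_le_mul _ (hs (hE.1 i hi).1) _ (hs (hE.1 i hi).2)
    _ = K * ∑ i ∈ Finset.range E.1, dist (x (E.2 i).1) (x (E.2 i).2) := by
        rw [Finset.mul_sum]
    _ ≤ K * (ε / (K + 1)) := by gcongr
    _ < (K + 1) * (ε / (K + 1)) := by
        have : (0 : ℝ) < ε / (K + 1) := by positivity
        nlinarith
    _ = ε := by field_simp

theorem AbsolutelyContinuousOnInterval.sub_le_mul_of_deriv_le {φ : ℝ → ℝ} {a b C : ℝ}
    (hφ : AbsolutelyContinuousOnInterval φ a b) (hab : a ≤ b)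
    (h : ∀ᵐ t, t ∈ Set.Ioo a b → deriv φ t ≤ C) : φ b - φ a ≤ C * (b - a) := by
  rw [← hφ.integral_deriv_eq_sub]
  have h2 : ∫ _ in a..b, C = C * (b - a) := by simp [mul_comm]
  rw [← h2]
  refine intervalIntegral.integral_mono_ae_restrict hab hφ.intervalIntegrable_deriv (by simp) ?_
  have hne : ∀ᵐ t : ℝ, t ≠ a ∧ t ≠ b := by
    filter_upwards [Measure.ae_ne volume a, Measure.ae_ne volume b] with t h1 h2 using ⟨h1, h2⟩
  rw [EventuallyLE, ae_restrict_iff' measurableSet_Icc]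
  filter_upwards [h, hne] with t ht h1 h2
  exact ht ⟨lt_of_le_of_ne h2.1 (Ne.symm h1.1), lt_of_le_of_ne h2.2 h1.2⟩

/-- Mean value theorem for curves: the slope of an absolutely continuous curve lies in every
closed convex set that contains almost all of its derivatives. A point outside the set would be
separated from it by a linear functional, against the scalar case. -/
theorem AbsolutelyContinuousOnInterval.slope_mem_of_deriv_mem {E : Type*} [NormedAddCommGroup E]
    [NormedSpace ℝ E] {x : ℝ → E} {a b : ℝ} {K : Set E}
    (hx : AbsolutelyContinuousOnInterval x a b) (hab : a < b) (hK : Convex ℝ K)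
    (hKc : IsClosed K) (h : ∀ᵐ t, t ∈ Set.Ioo a b → ∃ v ∈ K, HasDerivAt x v t) :
    (b - a)⁻¹ • (x b - x a) ∈ K := by
  by_contra hmem
  obtain ⟨l, u, hlu, hl⟩ := geometric_hahn_banach_point_closed hK hKc hmem
  have hac : AbsolutelyContinuousOnInterval ((-l) ∘ x) a b :=
    ((-l).lipschitz.lipschitzOnWith (s := Set.univ)).comp_absolutelyContinuousOnInterval hx
      (Set.mapsTo_univ _ _)
  have h1 := hac.sub_le_mul_of_deriv_le (C := -u) hab.le (by
    filter_upwards [h] with t ht hmt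
    obtain ⟨v, hv, hd⟩ := ht hmt
    have : HasDerivAt ((-l) ∘ x) ((-l) v) t := (-l).hasFDerivAt.comp_hasDerivAt t hd
    rw [this.deriv]
    simpa using (hl v hv).le)
  have hpos : 0 < b - a := sub_pos.2 hab
  have h2 : l (x b) - l (x a) < u * (b - a) := by
    simp only [map_smul, map_sub, smul_eq_mul] at hlu
    rwa [inv_mul_lt_iff₀ hpos, mul_comm (b - a)] at hlu
  simp only [Function.comp_apply, neg_apply] at h1
  linarith

theorem AbsolutelyContinuousOnInterval.norm_sub_le_of_norm_deriv_le {E : Type*}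
    [NormedAddCommGroup E] [NormedSpace ℝ E] {x : ℝ → E} {a b M : ℝ}
    (hx : AbsolutelyContinuousOnInterval x a b) (hab : a ≤ b)
    (h : ∀ᵐ t, t ∈ Set.Ioo a b → ∃ v, ‖v‖ ≤ M ∧ HasDerivAt x v t) :
    ‖x b - x a‖ ≤ M * (b - a) := by
  rcases hab.eq_or_lt with rfl | hlt
  · simp
  have := hx.slope_mem_of_deriv_mem hlt (convex_closedBall (0 : E) M) Metric.isClosed_closedBall
    (by simpa using h)
  rw [mem_closedBall_zero_iff, norm_smul, norm_inv, Real.norm_of_nonneg (by linarith),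
    inv_mul_le_iff₀ (by linarith)] at this
  linarith

/-! ### Convex hulls of compact sets -/

/-- By Carathéodory's theorem the convex hull is a finite union of continuous images of
`stdSimplex × (Fin k → s)`. -/
theorem IsCompact.isCompact_convexHull {E : Type*} [NormedAddCommGroup E] [NormedSpace ℝ E]
    [FiniteDimensional ℝ E] {s : Set E} (hs : IsCompact s) : IsCompact (convexHull ℝ s) := by
  have key : convexHull ℝ s = ⋃ k ∈ Finset.range (Module.finrank ℝ E + 2),
      (fun p : (Fin k → ℝ) × (Fin k → E) => ∑ i, p.1 i • p.2 i) ''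
        (stdSimplex ℝ (Fin k) ×ˢ Set.univ.pi fun _ => s) := by
    refine Set.Subset.antisymm (fun x hx => ?_) ?_
    · obtain ⟨ι, _, z, w, hz, hai, hw, hsum, hx⟩ := eq_pos_convex_span_of_mem_convexHull hx
      have hcard : Fintype.card ι < Module.finrank ℝ E + 2 := by
        have h1 := hai.card_le_finrank_succ
        have h2 := Submodule.finrank_le (vectorSpan ℝ (Set.range z))
        omega
      let e := (Fintype.equivFin ι).symm
      refine Set.mem_biUnion (Finset.mem_coe.2 (Finset.mem_range.2 hcard))
        ⟨(w ∘ e, z ∘ e), ⟨⟨fun i => (hw _).le, ?_⟩, fun i _ => hz ⟨_, rfl⟩⟩, ?_⟩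
      · rw [← hsum]; exact e.sum_comp w
      · rw [← hx]; exact e.sum_comp fun i => w i • z i
    · refine Set.iUnion₂_subset fun k _ => ?_
      rintro _ ⟨p, ⟨hp1, hp2⟩, rfl⟩
      exact (convex_convexHull ℝ s).sum_mem (fun i _ => hp1.1 i) hp1.2
        fun i _ => subset_convexHull ℝ s (hp2 i trivial)
  rw [key]
  refine (Finset.range _).isCompact_biUnion fun k _ => ?_
  exact ((isCompact_stdSimplex ℝ (Fin k)).prod (isCompact_univ_pi fun _ => hs)).image (by fun_prop)

/-! ### Locally Lipschitz functions and their gradients -/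

theorem LocallyLipschitz.ae_differentiableAt_real {E : Type*} [NormedAddCommGroup E]
    [NormedSpace ℝ E] [FiniteDimensional ℝ E] [MeasurableSpace E] [BorelSpace E] {f : E → ℝ}
    (hf : LocallyLipschitz f) {μ : Measure E} [μ.IsAddHaarMeasure] :
    ∀ᵐ y ∂μ, DifferentiableAt ℝ f y := by
  refine measure_null_of_locally_null _ fun x _ => ?_
  obtain ⟨K, t, ht, hK⟩ := hf x
  obtain ⟨U, hUt, hU, hxU⟩ := mem_nhds_iff.1 ht
  refine ⟨{y | ¬ DifferentiableAt ℝ f y} ∩ U, inter_mem_nhdsWithin _ (hU.mem_nhds hxU), ?_⟩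
  have h1 := (hK.mono hUt).ae_differentiableWithinAt_of_mem (μ := μ)
  rw [measure_eq_zero_iff_ae_notMem]
  filter_upwards [h1] with y hy hmem
  exact hmem.1 ((hy hmem.2).differentiableAt (hU.mem_nhds hmem.2))

/-- An almost everywhere bound on the derivative in the direction `v` bounds all increments in
that direction: by Fubini's theorem it holds on almost every line parallel to `v`, and the
increments are continuous in the base point. -/
theorem LipschitzOnWith.sub_le_mul_of_ae_fderiv_le {E : Type*} [NormedAddCommGroup E]
    [NormedSpace ℝ E] [FiniteDimensional ℝ E] [MeasurableSpace E] [BorelSpace E] {f : E → ℝ}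
    {μ : Measure E} [μ.IsAddHaarMeasure] {K : NNReal} {x v : E} {r c : ℝ}
    (hf : LipschitzOnWith K f (Metric.ball x r))
    (h : ∀ᵐ y ∂μ, y ∈ Metric.ball x r → DifferentiableAt ℝ f y ∧ fderiv ℝ f y v ≤ c)
    {y : E} {s : ℝ} (hs : 0 ≤ s) (hy : y ∈ Metric.ball x r) (hys : y + s • v ∈ Metric.ball x r) :
    f (y + s • v) - f y ≤ c * s := by
  have hprod : ∀ᵐ p : E × ℝ ∂(μ.prod volume), p.1 + p.2 • v ∈ Metric.ball x r →
      DifferentiableAt ℝ f (p.1 + p.2 • v) ∧ fderiv ℝ f (p.1 + p.2 • v) v ≤ c := by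
    have hq : Measure.QuasiMeasurePreserving (fun p : E × ℝ => p.1 + p.2 • v)
        (μ.prod volume) μ :=
      QuasiMeasurePreserving.prod_of_left (by fun_prop) (Eventually.of_forall fun t =>
        (measurePreserving_add_right μ (t • v)).quasiMeasurePreserving)
    exact hq.ae h
  have hline := Measure.ae_ae_of_ae_prod hprod
  have hgood : ∀ᵐ z ∂μ, z ∈ Metric.ball x r → z + s • v ∈ Metric.ball x r →
      f (z + s • v) - f z ≤ c * s := by
    filter_upwards [hline] with z hz h1 h2
    have hseg : Set.MapsTo (fun t : ℝ => z + t • v) (Set.uIcc 0 s) (Metric.ball x r) := by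
      intro t ht
      rw [Set.uIcc_of_le hs] at ht
      have hconv := (convex_ball x r).segment_subset h1 h2
      rcases hs.eq_or_lt with rfl | hs0
      · obtain rfl : t = 0 := le_antisymm ht.2 ht.1
        simpa using h1
      · refine hconv ?_
        rw [segment_eq_image']
        refine ⟨t / s, ⟨div_nonneg ht.1 hs, (div_le_one hs0).2 ht.2⟩, ?_⟩
        simp only [add_sub_cancel_left, smul_smul]
        rw [div_mul_cancel₀ _ hs0.ne']
    have hl : AbsolutelyContinuousOnInterval (fun t : ℝ => z + t • v) 0 s := by
      refine ContDiffOn.absolutelyContinuousOnInterval ?_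
      fun_prop
    have hac := hf.comp_absolutelyContinuousOnInterval hl hseg
    have := hac.sub_le_mul_of_deriv_le (C := c) hs (by
      filter_upwards [hz] with t ht hmt
      obtain ⟨hd, hle⟩ := ht (hseg (by rw [Set.uIcc_of_le hs]; exact ⟨hmt.1.le, hmt.2.le⟩))
      have hld : HasDerivAt (fun t : ℝ => z + t • v) v t := by
        simpa using ((hasDerivAt_id t).smul_const v).const_add z
      rw [(hd.hasFDerivAt.comp_hasDerivAt t hld).deriv]
      exact hle)
    simpa using this
  have hdense := Measure.dense_of_ae hgood
  have hfr := mem_closure_iff_frequently.1 (hdense y)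
  have hcont : ContinuousAt f y :=
    hf.continuousOn.continuousAt (Metric.isOpen_ball.mem_nhds hy)
  have hcont' : ContinuousAt (fun z => f (z + s • v)) y :=
    ContinuousAt.comp (f := fun z => z + s • v)
      (hf.continuousOn.continuousAt (Metric.isOpen_ball.mem_nhds hys)) (by fun_prop)
  refine le_of_tendsto_of_frequently (hcont'.sub hcont) ?_
  have e1 : ∀ᶠ z in 𝓝 y, z ∈ Metric.ball x r := Metric.isOpen_ball.mem_nhds hy
  have e2 : ∀ᶠ z in 𝓝 y, z + s • v ∈ Metric.ball x r :=
    (show ContinuousAt (fun z => z + s • v) y by fun_prop).eventually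
      (Metric.isOpen_ball.mem_nhds hys)
  exact (hfr.and_eventually (e1.and e2)).mono fun z hz => hz.1 hz.2.1 hz.2.2

/-! ### Existence of Filippov solutions -/

/-- A mollified vector field takes its values in every closed convex set that contains almost
all values of the field on the ball over which it is averaged. -/
theorem ContDiffBump.normed_convolution_mem {E F : Type*} [NormedAddCommGroup E] [NormedSpace ℝ E]
    [FiniteDimensional ℝ E] [MeasurableSpace E] [BorelSpace E] [NormedAddCommGroup F]
    [NormedSpace ℝ F] [CompleteSpace F] {μ : Measure E} [μ.IsAddHaarMeasure]
    (φ : ContDiffBump (0 : E)) {Y : E → F} (hY : Integrable Y μ) {K : Set F} (hK : Convex ℝ K)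
    (hKc : IsClosed K) {p : E} (h : ∀ᵐ y ∂μ, y ∈ Metric.ball p φ.rOut → Y y ∈ K) :
    convolution (φ.normed μ) Y (ContinuousLinearMap.lsmul ℝ ℝ) μ p ∈ K := by
  by_contra hmem
  obtain ⟨l, u, hlu, hl⟩ := geometric_hahn_banach_point_closed hK hKc hmem
  have hconv : ConvolutionExistsAt (φ.normed μ) Y p (ContinuousLinearMap.lsmul ℝ ℝ) μ :=
    (φ.hasCompactSupport_normed.convolutionExists_left _ φ.continuous_normed
      hY.locallyIntegrable) p
  have hint : Integrable (fun t => φ.normed μ t • Y (p - t)) μ := hconv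
  have hint' : Integrable (fun t => φ.normed μ t * l (Y (p - t))) μ := by
    simpa using l.integrable_comp hint
  have heq : l (convolution (φ.normed μ) Y (ContinuousLinearMap.lsmul ℝ ℝ) μ p) =
      ∫ t, φ.normed μ t * l (Y (p - t)) ∂μ := by
    rw [convolution_def]
    simp only [ContinuousLinearMap.lsmul_apply]
    rw [← l.integral_comp_comm hint]
    simp
  have hu : u = ∫ t, φ.normed μ t * u ∂μ := by
    rw [integral_mul_const, φ.integral_normed, one_mul]
  rw [heq] at hlu
  refine absurd hlu (not_lt.2 ?_)
  rw [hu]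
  refine integral_mono_ae (φ.integrable_normed.mul_const u) hint' ?_
  filter_upwards [(Measure.measurePreserving_sub_left μ p).quasiMeasurePreserving.ae h] with t ht
  by_cases h0 : φ.normed μ t = 0
  · simp [h0]
  · have hmt : t ∈ Metric.ball (0 : E) φ.rOut := by
      rw [← φ.support_normed_eq (μ := μ)]; exact h0
    refine mul_le_mul_of_nonneg_left (hl _ (ht ?_)).le (φ.nonneg_normed t)
    simpa [Metric.mem_ball, dist_eq_norm] using hmt

/-- A bounded `C¹` vector field has an integral curve on `[0, 1]` from every point; it is extended
to all times by constants. -/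
theorem exists_integralCurve_Icc_of_bounded {E : Type*} [NormedAddCommGroup E]
    [NormedSpace ℝ E] [FiniteDimensional ℝ E] {V : E → E} (hV : ContDiff ℝ 1 V) {M : NNReal}
    (hM : ∀ y, ‖V y‖ ≤ M) (x₀ : E) :
    ∃ x : ℝ → E, x 0 = x₀ ∧ LipschitzWith M x ∧
      ∀ t ∈ Set.Ioo (0 : ℝ) 1, HasDerivAt x (V (x t)) t := by
  have : ProperSpace E := FiniteDimensional.proper ℝ E
  obtain ⟨K, hK⟩ := hV.contDiffOn.exists_lipschitzOnWith (by norm_num)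
    (convex_closedBall x₀ (M : ℝ)) (isCompact_closedBall x₀ (M : ℝ))
  have hpl : IsPicardLindelof (fun _ => V) (tmin := 0) (tmax := 1) ⟨0, by simp⟩ x₀ M 0 M K :=
    IsPicardLindelof.of_time_independent (fun y _ => hM y) hK (by simp)
  obtain ⟨α, h0, hα⟩ := hpl.exists_eq_forall_mem_Icc_hasDerivWithinAt₀
  have hlip : LipschitzOnWith M α (Set.Icc 0 1) :=
    (convex_Icc (0 : ℝ) 1).lipschitzOnWith_of_nnnorm_hasDerivWithin_le hα fun t _ => hM _
  refine ⟨fun t => α (Set.projIcc (0 : ℝ) 1 zero_le_one t), ?_, ?_, ?_⟩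
  · simpa [Set.projIcc_left] using h0
  · have := (lipschitzOnWith_iff_restrict.1 hlip).comp
      (LipschitzWith.projIcc (zero_le_one' ℝ))
    rwa [mul_one] at this
  · intro t ht
    have h1 : HasDerivAt α (V (α t)) t := (hα t ⟨ht.1.le, ht.2.le⟩).hasDerivAt
      (Icc_mem_nhds ht.1 ht.2)
    have h2 : (fun s => α (Set.projIcc (0 : ℝ) 1 zero_le_one s)) =ᶠ[𝓝 t] α := by
      filter_upwards [Ioo_mem_nhds ht.1 ht.2] with s hs
      rw [Set.projIcc_of_mem zero_le_one ⟨hs.1.le, hs.2.le⟩]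
    have h3 := h2.hasDerivAt_iff.2 h1
    rwa [← h2.eq_of_nhds] at h3

/-- Local existence for Filippov solutions of a bounded measurable vector field. The curve is a
pointwise limit, along an ultrafilter, of integral curves of mollified fields. Over a short time
interval the slopes of these curves lie in each closed convex hull in the definition of the
Filippov map, and this passes to the limit. -/
theorem exists_filippov_solution {d : ℕ}
    {X : EuclideanSpace ℝ (Fin d) → EuclideanSpace ℝ (Fin d)}
    (hX : AEStronglyMeasurable X volume) {x₀ : EuclideanSpace ℝ (Fin d)} {R : ℝ} (hR : 0 < R)
    {M : NNReal} (hM : ∀ y ∈ Metric.ball x₀ R, ‖X y‖ ≤ M) :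
    ∃ τ > 0, ∃ z : ℝ → EuclideanSpace ℝ (Fin d), z 0 = x₀ ∧ LipschitzWith M z ∧
      ∀ᵐ t, t ∈ Set.Ioo 0 τ → ∃ v ∈ filippovMap X (z t), HasDerivAt z v t := by
  set Y := (Metric.ball x₀ R).indicator X with hYdef
  have hYM : ∀ y, ‖Y y‖ ≤ M := fun y => by
    by_cases hy : y ∈ Metric.ball x₀ R
    · simpa [hYdef, hy] using hM y hy
    · simp [hYdef, hy]
  have hYint : Integrable Y volume := by
    rw [hYdef, integrable_indicator_iff measurableSet_ball]
    refine Measure.integrableOn_of_bounded (M := M) measure_ball_lt_top.ne hX ?_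
    filter_upwards [ae_restrict_mem measurableSet_ball] with y hy using hM y hy
  have hpos : ∀ n : ℕ, (0 : ℝ) < 1 / (n + 1) := fun n => by positivity
  let φ : ℕ → ContDiffBump (0 : EuclideanSpace ℝ (Fin d)) := fun n =>
    ⟨1 / (n + 1) / 2, 1 / (n + 1), half_pos (hpos n), half_lt_self (hpos n)⟩
  let V : ℕ → EuclideanSpace ℝ (Fin d) → EuclideanSpace ℝ (Fin d) := fun n =>
    convolution ((φ n).normed volume) Y (ContinuousLinearMap.lsmul ℝ ℝ) volume
  have hVc : ∀ n, ContDiff ℝ 1 (V n) := fun n =>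
    (φ n).hasCompactSupport_normed.contDiff_convolution_left _ (φ n).contDiff_normed
      hYint.locallyIntegrable
  have hVmem : ∀ (n : ℕ) p (K : Set (EuclideanSpace ℝ (Fin d))), Convex ℝ K → IsClosed K →
      (∀ᵐ y, y ∈ Metric.ball p (1 / (n + 1) : ℝ) → Y y ∈ K) → V n p ∈ K :=
    fun n p K hK hKc h => (φ n).normed_convolution_mem hYint hK hKc h
  have hVM : ∀ n y, ‖V n y‖ ≤ M := fun n y => by
    have := hVmem n y _ (convex_closedBall 0 (M : ℝ)) Metric.isClosed_closedBall
      (Eventually.of_forall fun y _ => by simpa using hYM y)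
    simpa using this
  choose x hx0 hxL hxd using fun n => exists_integralCurve_Icc_of_bounded (hVc n) (hVM n) x₀
  have hlim : ∀ t, ∃ p, Tendsto (fun n => x n t) (hyperfilter ℕ : Filter ℕ) (𝓝 p) := by
    intro t
    have hball : ∀ n, x n t ∈ Metric.closedBall x₀ (M * |t|) := fun n => by
      have := (hxL n).dist_le_mul t 0
      rw [hx0 n] at this
      simpa [Real.dist_eq] using this
    obtain ⟨p, -, hp⟩ := (isCompact_closedBall x₀ (M * |t| : ℝ)).ultrafilter_le_nhds
      ((hyperfilter ℕ).map fun n => x n t) (by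
        rw [le_principal_iff]; exact mem_map.2 (Eventually.of_forall hball))
    exact ⟨p, hp⟩
  -- no measurability or continuity of the choice is needed: `z` inherits the Lipschitz bound
  choose z hz using hlim
  have hz0 : z 0 = x₀ := by
    refine tendsto_nhds_unique (hz 0) ?_
    simp only [hx0]
    exact tendsto_const_nhds
  have hzL : LipschitzWith M z := LipschitzWith.of_dist_le_mul fun s t =>
    le_of_tendsto ((hz s).dist (hz t)) (Eventually.of_forall fun n => (hxL n).dist_le_mul s t)
  refine ⟨min 1 (R / (M + 1)), by positivity, z, hz0, hzL, ?_⟩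
  filter_upwards [hzL.ae_differentiableAt] with t ht hmt
  refine ⟨deriv z t, ?_, ht.hasDerivAt⟩
  simp only [filippovMap, Set.mem_iInter]
  intro δ hδ S hS
  set K := closure (convexHull ℝ (X '' (Metric.ball (z t) δ \ S))) with hKdef
  have hKconv : Convex ℝ K := (convex_convexHull ℝ _).closure
  have hzt : dist (z t) x₀ < R := by
    have h1 := hzL.dist_le_mul t 0
    rw [hz0, Real.dist_eq, sub_zero, abs_of_pos hmt.1] at h1
    have h2 : t < R / (M + 1) := hmt.2.trans_le (min_le_right _ _)
    rw [lt_div_iff₀ (by positivity)] at h2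
    nlinarith [hmt.1]
  -- a ball around `z t` inside both the ball of the Filippov map and the domain of the bound `M`
  obtain ⟨ρ, hρ, hρδ, hρR⟩ : ∃ ρ > 0, ρ ≤ δ ∧ ρ + dist (z t) x₀ ≤ R :=
    ⟨min δ (R - dist (z t) x₀), lt_min hδ (sub_pos.2 hzt), min_le_left _ _, by
      have := min_le_right δ (R - dist (z t) x₀)
      linarith⟩
  have hKY : ∀ᵐ y, y ∈ Metric.ball (z t) ρ → Y y ∈ K := by
    filter_upwards [measure_eq_zero_iff_ae_notMem.1 hS] with y hyS hy
    have hyR : y ∈ Metric.ball x₀ R :=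
      Metric.ball_subset_ball' hρR hy
    rw [hYdef, Set.indicator_of_mem hyR]
    exact subset_closure (subset_convexHull ℝ _ ⟨y, ⟨Metric.ball_subset_ball hρδ hy, hyS⟩, rfl⟩)
  refine isClosed_closure.mem_of_tendsto ht.hasDerivAt.tendsto_slope_zero_right ?_
  have hM4 : 0 < ρ / (4 * (M + 1)) := by positivity
  have ht1 : 0 < 1 - t := sub_pos.2 (hmt.2.trans_le (min_le_left _ _))
  -- for such `h`, the curves `x n` move by at most `ρ / 4` on `[t, t + h]`
  filter_upwards [Ioo_mem_nhdsGT (lt_min hM4 ht1)] with h hh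
  have hh1 : M * h ≤ ρ / 4 := by
    have := hh.2.le.trans (min_le_left _ _)
    rw [le_div_iff₀ (by positivity)] at this
    nlinarith [hh.1]
  have hh2 : t + h < 1 := by
    have := hh.2.trans_le (min_le_right _ _)
    linarith
  refine isClosed_closure.mem_of_tendsto
    (((hz (t + h)).sub (hz t)).const_smul h⁻¹) ?_
  have hn1 : ∀ᶠ n in (hyperfilter ℕ : Filter ℕ), dist (x n t) (z t) < ρ / 4 :=
    (hz t).eventually (Metric.ball_mem_nhds _ (by positivity))
  have hn2 : ∀ᶠ n : ℕ in (hyperfilter ℕ : Filter ℕ), 1 / ((n : ℝ) + 1) < ρ / 4 := by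
    have : (hyperfilter ℕ : Filter ℕ) ≤ atTop := by
      rw [← Nat.cofinite_eq_atTop]; exact hyperfilter_le_cofinite
    exact this ((tendsto_one_div_add_atTop_nhds_zero_nat (𝕜 := ℝ)).eventually
      (gt_mem_nhds (by positivity)))
  filter_upwards [hn1, hn2] with n h1 h2
  have := ((hxL n).lipschitzOnWith.absolutelyContinuousOnInterval
    (a := t) (b := t + h)).slope_mem_of_deriv_mem (by linarith [hh.1]) hKconv isClosed_closure (by
      refine Eventually.of_forall fun s hs => ⟨_, ?_, hxd n s ⟨hmt.1.trans hs.1, hs.2.trans hh2⟩⟩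
      refine hVmem n _ _ hKconv isClosed_closure ?_
      filter_upwards [hKY] with y hy hys
      refine hy (Metric.mem_ball.2 ?_)
      have e1 : dist (x n s) (x n t) ≤ M * h := by
        refine ((hxL n).dist_le_mul s t).trans ?_
        rw [Real.dist_eq, abs_of_pos (sub_pos.2 hs.1)]
        exact mul_le_mul_of_nonneg_left (by linarith [hs.2]) M.coe_nonneg
      have e2 := dist_triangle4 y (x n s) (x n t) (z t)
      have e3 := Metric.mem_ball.1 hys
      linarith)
  rwa [add_sub_cancel_left] at this

section GeneralizedGradient

variable {d : ℕ} {f : EuclideanSpace ℝ (Fin d) → ℝ}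

/-! ### Limiting gradients and the generalized gradient -/

/-- The set of limits of gradients of `f` along sequences of points of differentiability that
converge to `x`; the generalized gradient is its convex hull. -/
def limitingGradients (f : EuclideanSpace ℝ (Fin d) → ℝ) (x : EuclideanSpace ℝ (Fin d)) :
    Set (EuclideanSpace ℝ (Fin d)) :=
  {ζ | ∃ u : ℕ → EuclideanSpace ℝ (Fin d),
    Tendsto u atTop (𝓝 x) ∧ (∀ i, DifferentiableAt ℝ f (u i)) ∧
      Tendsto (fun i => gradient f (u i)) atTop (𝓝 ζ)}

theorem mem_limitingGradients_iff {x ζ : EuclideanSpace ℝ (Fin d)} :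
    ζ ∈ limitingGradients f x ↔
      (x, ζ) ∈ closure ((fun y => (y, gradient f y)) '' {y | DifferentiableAt ℝ f y}) := by
  rw [mem_closure_iff_seq_limit]
  constructor
  · rintro ⟨u, hu, hd, hg⟩
    exact ⟨fun i => (u i, gradient f (u i)), fun i => ⟨u i, hd i, rfl⟩, hu.prodMk_nhds hg⟩
  · rintro ⟨p, hp, hlim⟩
    choose u hd hu using hp
    obtain rfl : p = fun i => (u i, gradient f (u i)) := funext fun i => (hu i).symm
    exact ⟨u, (continuous_fst.tendsto _).comp hlim, hd, (continuous_snd.tendsto _).comp hlim⟩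

theorem isClosed_limitingGradients (x : EuclideanSpace ℝ (Fin d)) :
    IsClosed (limitingGradients f x) := by
  have : limitingGradients f x = (fun ζ => (x, ζ)) ⁻¹'
      closure ((fun y => (y, gradient f y)) '' {y | DifferentiableAt ℝ f y}) := by
    ext ζ; exact mem_limitingGradients_iff
  rw [this]
  exact isClosed_closure.preimage (by fun_prop)

theorem LocallyLipschitz.exists_norm_gradient_le (hf : LocallyLipschitz f)
    (x : EuclideanSpace ℝ (Fin d)) :
    ∃ K : NNReal, ∀ᶠ y in 𝓝 x, ‖gradient f y‖ ≤ K := by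
  obtain ⟨K, t, ht, hK⟩ := hf x
  refine ⟨K, (eventually_mem_nhds_iff.2 ht).mono fun y hy => ?_⟩
  rw [gradient, LinearIsometryEquiv.norm_map]
  exact norm_fderiv_le_of_lipschitzOn ℝ hy hK

/-- Gradients taken along points of differentiability tending to `x` accumulate in
`limitingGradients f x`. -/
theorem LocallyLipschitz.exists_mem_limitingGradients_mapClusterPt (hf : LocallyLipschitz f)
    (x : EuclideanSpace ℝ (Fin d)) {s : Set (EuclideanSpace ℝ (Fin d))}
    (hs : ∃ᶠ y in 𝓝 x, DifferentiableAt ℝ f y ∧ y ∈ s) :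
    ∃ ζ ∈ limitingGradients f x,
      MapClusterPt ζ (𝓝 x ⊓ 𝓟 {y | DifferentiableAt ℝ f y ∧ y ∈ s}) (gradient f) := by
  obtain ⟨K, hK⟩ := hf.exists_norm_gradient_le x
  have hne : (𝓝 x ⊓ 𝓟 {y | DifferentiableAt ℝ f y ∧ y ∈ s}).NeBot := frequently_mem_iff_neBot.1 hs
  obtain ⟨ζ, -, hζ⟩ := (isCompact_closedBall (0 : EuclideanSpace ℝ (Fin d)) K).exists_mapClusterPt
    (f := 𝓝 x ⊓ 𝓟 {y | DifferentiableAt ℝ f y ∧ y ∈ s}) (u := gradient f)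
    (le_principal_iff.2 (mem_map.2 (mem_inf_of_left (hK.mono fun y hy => by simpa using hy))))
  refine ⟨ζ, mem_limitingGradients_iff.2 (mem_closure_iff_nhds.2 fun t ht => ?_), hζ⟩
  obtain ⟨U, hU, W, hW, hUW⟩ := mem_nhds_prod_iff.1 ht
  obtain ⟨y, hyW, hyU, hy⟩ := ((hζ.frequently hW).and_eventually
    (inter_mem_inf hU (mem_principal_self _))).exists
  exact ⟨(y, gradient f y), hUW ⟨hyU, hyW⟩, y, hy.1, rfl⟩

theorem LocallyLipschitz.limitingGradients_nonempty (hf : LocallyLipschitz f)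
    (x : EuclideanSpace ℝ (Fin d)) : (limitingGradients f x).Nonempty := by
  have hd := Measure.dense_of_ae (hf.ae_differentiableAt_real (μ := volume))
  obtain ⟨ζ, hζ, -⟩ := hf.exists_mem_limitingGradients_mapClusterPt x (s := Set.univ)
    ((mem_closure_iff_frequently.1 (hd x)).mono fun y hy => ⟨hy, trivial⟩)
  exact ⟨ζ, hζ⟩

theorem LocallyLipschitz.generalizedGradient_nonempty (hf : LocallyLipschitz f)
    (x : EuclideanSpace ℝ (Fin d)) : (generalizedGradient f x).Nonempty :=
  (hf.limitingGradients_nonempty x).mono (subset_convexHull ℝ _)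

theorem LocallyLipschitz.gradient_mem_thickening (hf : LocallyLipschitz f)
    (x : EuclideanSpace ℝ (Fin d)) {ε : ℝ} (hε : 0 < ε) :
    ∀ᶠ y in 𝓝 x, DifferentiableAt ℝ f y →
      gradient f y ∈ Metric.thickening ε (limitingGradients f x) := by
  by_contra h
  simp only [not_eventually, Classical.not_imp] at h
  obtain ⟨ζ, hζ, hcl⟩ := hf.exists_mem_limitingGradients_mapClusterPt x
    (s := {y | gradient f y ∉ Metric.thickening ε (limitingGradients f x)}) h
  obtain ⟨y, hy1, hy2⟩ := ((hcl.frequently (Metric.ball_mem_nhds ζ hε)).and_eventually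
    (mem_inf_of_right (mem_principal_self _))).exists
  exact hy2.2 (Metric.mem_thickening_iff.2 ⟨ζ, hζ, hy1⟩)

/-- Upper semicontinuity of the generalized gradient. -/
theorem LocallyLipschitz.closure_generalizedGradient_subset_cthickening (hf : LocallyLipschitz f)
    (x : EuclideanSpace ℝ (Fin d)) {ε : ℝ} (hε : 0 < ε) :
    ∀ᶠ y in 𝓝 x, closure (generalizedGradient f y) ⊆
      Metric.cthickening ε (generalizedGradient f x) := by
  filter_upwards [eventually_eventually_nhds.2 (hf.gradient_mem_thickening x hε)] with y hy
  refine closure_minimal (convexHull_min ?_ ((convex_convexHull ℝ _).cthickening ε))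
    Metric.isClosed_cthickening
  rintro ζ ⟨u, hu, hd, hg⟩
  refine Metric.isClosed_cthickening.mem_of_tendsto hg ((hu.eventually hy).mono fun i hi => ?_)
  exact Metric.thickening_subset_cthickening _ _
    (Metric.thickening_subset_of_subset _ (subset_convexHull ℝ _) (hi (hd i)))

theorem LocallyLipschitz.exists_norm_le_of_mem_closure_generalizedGradient_nhds
    (hf : LocallyLipschitz f) (x : EuclideanSpace ℝ (Fin d)) :
    ∃ K : NNReal, ∀ᶠ y in 𝓝 x, ∀ ζ ∈ closure (generalizedGradient f y), ‖ζ‖ ≤ K := by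
  obtain ⟨K, hK⟩ := hf.exists_norm_gradient_le x
  refine ⟨K, (eventually_eventually_nhds.2 hK).mono fun y hy ζ hζ => ?_⟩
  have hsub : closure (generalizedGradient f y) ⊆ Metric.closedBall 0 K := by
    refine closure_minimal (convexHull_min ?_ (convex_closedBall _ _)) Metric.isClosed_closedBall
    rintro ζ ⟨u, hu, hd, hg⟩
    exact Metric.isClosed_closedBall.mem_of_tendsto hg
      ((hu.eventually hy).mono fun i hi => by simpa using hi)
  simpa using hsub hζ

theorem LocallyLipschitz.exists_norm_le_of_mem_closure_generalizedGradient
    (hf : LocallyLipschitz f) {C : Set (EuclideanSpace ℝ (Fin d))} (hC : IsCompact C) :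
    ∃ K : NNReal, ∀ y ∈ C, ∀ ζ ∈ closure (generalizedGradient f y), ‖ζ‖ ≤ K := by
  refine hC.induction_on (p := fun s => ∃ K : NNReal, ∀ y ∈ s,
    ∀ ζ ∈ closure (generalizedGradient f y), ‖ζ‖ ≤ K) ⟨0, by simp⟩ ?_ ?_ ?_
  · rintro s t hst ⟨K, hK⟩
    exact ⟨K, fun y hy => hK y (hst hy)⟩
  · rintro s t ⟨K, hK⟩ ⟨K', hK'⟩
    refine ⟨max K K', fun y hy ζ hζ => ?_⟩
    rcases hy with hy | hy
    · exact (hK y hy ζ hζ).trans (by exact_mod_cast le_max_left K K')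
    · exact (hK' y hy ζ hζ).trans (by exact_mod_cast le_max_right K K')
  · intro x _
    obtain ⟨K, hK⟩ := hf.exists_norm_le_of_mem_closure_generalizedGradient_nhds x
    exact ⟨_, mem_nhdsWithin_of_mem_nhds hK, K, fun y hy => hy⟩

theorem LocallyLipschitz.isClosed_generalizedGradient (hf : LocallyLipschitz f)
    (x : EuclideanSpace ℝ (Fin d)) : IsClosed (generalizedGradient f x) := by
  obtain ⟨K, hK⟩ := hf.exists_norm_le_of_mem_closure_generalizedGradient_nhds x
  have hc : IsCompact (limitingGradients f x) := by
    refine Metric.isCompact_of_isClosed_isBounded (isClosed_limitingGradients x)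
      (isBounded_iff_forall_norm_le.2 ⟨K, fun ζ hζ => ?_⟩)
    exact hK.self_of_nhds ζ (subset_closure (subset_convexHull ℝ _ hζ))
  exact hc.isCompact_convexHull.isClosed

theorem LocallyLipschitz.neg_nonsmoothGradientField_mem_leastNormSet (hf : LocallyLipschitz f)
    (x : EuclideanSpace ℝ (Fin d)) :
    -nonsmoothGradientField f x ∈ leastNormSet (generalizedGradient f x) := by
  rw [nonsmoothGradientField, neg_neg, leastNormSet_eq_singleton
    (hf.generalizedGradient_nonempty x) (convex_convexHull ℝ _)]
  rfl

/-- The Filippov map of the gradient field selects negatives of generalized gradients, by upper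
semicontinuity. -/
theorem LocallyLipschitz.neg_mem_closure_generalizedGradient (hf : LocallyLipschitz f)
    {x v : EuclideanSpace ℝ (Fin d)} (hv : v ∈ filippovMap (nonsmoothGradientField f) x) :
    -v ∈ closure (generalizedGradient f x) := by
  rw [Metric.closure_eq_iInter_cthickening, Set.mem_iInter₂]
  intro ε hε
  obtain ⟨δ, hδ, hball⟩ :=
    Metric.eventually_nhds_iff_ball.1 (hf.closure_generalizedGradient_subset_cthickening x hε)
  simp only [filippovMap, Set.mem_iInter] at hv
  have hv' := hv δ hδ ∅ (by simp)
  have hsub : closure (convexHull ℝ (nonsmoothGradientField f '' (Metric.ball x δ \ ∅))) ⊆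
      Neg.neg ⁻¹' Metric.cthickening ε (generalizedGradient f x) := by
    refine closure_minimal (convexHull_min ?_ ?_) (Metric.isClosed_cthickening.preimage
      continuous_neg)
    · rintro _ ⟨y, hy, rfl⟩
      exact hball y hy.1 (hf.neg_nonsmoothGradientField_mem_leastNormSet y).1
    · exact ((convex_convexHull ℝ _).cthickening ε).neg
  exact hsub hv'

/-- Away from critical points, generalized gradients are bounded below in norm, locally
uniformly. -/
theorem LocallyLipschitz.exists_le_norm_of_notMem_criticalSet (hf : LocallyLipschitz f)
    {x : EuclideanSpace ℝ (Fin d)} (hx : x ∉ criticalSet f) :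
    ∃ c > 0, ∀ᶠ y in 𝓝 x, ∀ ζ ∈ closure (generalizedGradient f y), c ≤ ‖ζ‖ := by
  have h0 : (0 : EuclideanSpace ℝ (Fin d)) ∉ closure (generalizedGradient f x) := by
    rwa [(hf.isClosed_generalizedGradient x).closure_eq]
  obtain ⟨ε, hε, hball⟩ := Metric.isOpen_iff.1 isClosed_closure.isOpen_compl _ h0
  refine ⟨ε / 2, half_pos hε, ?_⟩
  filter_upwards [hf.closure_generalizedGradient_subset_cthickening x
    (half_pos (half_pos hε))] with y hy ζ hζ
  by_contra! hlt
  have h1 := Metric.cthickening_subset_thickening' (half_pos hε) (by linarith)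
    (generalizedGradient f x) (hy hζ)
  obtain ⟨w, hw, hdist⟩ := Metric.mem_thickening_iff.1 h1
  refine hball (a := w) ?_ (subset_closure hw)
  rw [mem_ball_zero_iff]
  have := norm_sub_norm_le w ζ
  rw [dist_comm, dist_eq_norm] at hdist
  linarith

theorem LocallyLipschitz.exists_le_norm_of_disjoint_criticalSet (hf : LocallyLipschitz f)
    {C : Set (EuclideanSpace ℝ (Fin d))} (hC : IsCompact C) (hdisj : Disjoint C (criticalSet f)) :
    ∃ c > 0, ∀ y ∈ C, ∀ ζ ∈ closure (generalizedGradient f y), c ≤ ‖ζ‖ := by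
  refine hC.induction_on (p := fun s => ∃ c > 0, ∀ y ∈ s,
    ∀ ζ ∈ closure (generalizedGradient f y), c ≤ ‖ζ‖) ⟨1, by simp⟩ ?_ ?_ ?_
  · rintro s t hst ⟨c, hc, h⟩
    exact ⟨c, hc, fun y hy => h y (hst hy)⟩
  · rintro s t ⟨c, hc, h⟩ ⟨c', hc', h'⟩
    refine ⟨min c c', lt_min hc hc', fun y hy ζ hζ => ?_⟩
    rcases hy with hy | hy
    · exact (min_le_left _ _).trans (h y hy ζ hζ)
    · exact (min_le_right _ _).trans (h' y hy ζ hζ)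
  · intro x hx
    obtain ⟨c, hc, h⟩ := hf.exists_le_norm_of_notMem_criticalSet (hdisj.notMem_of_mem_left hx)
    exact ⟨_, mem_nhdsWithin_of_mem_nhds h, c, hc, fun y hy => hy⟩

end GeneralizedGradient

section DirectionalDerivative

variable {d : ℕ} {f : EuclideanSpace ℝ (Fin d) → ℝ}

/-! ### Directional derivatives of regular functions -/

theorem LocallyLipschitz.exists_differenceQuotient_le (hf : LocallyLipschitz f)
    (x v : EuclideanSpace ℝ (Fin d)) :
    ∃ C : ℝ, ∀ᶠ p : EuclideanSpace ℝ (Fin d) × ℝ in 𝓝 x ×ˢ 𝓝[>] (0 : ℝ),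
      (f (p.1 + p.2 • v) - f p.1) / p.2 ≤ C := by
  obtain ⟨K, t, ht, hK⟩ := hf x
  refine ⟨K * ‖v‖, ?_⟩
  have h0 : ∀ᶠ p : EuclideanSpace ℝ (Fin d) × ℝ in 𝓝 x ×ˢ 𝓝[>] (0 : ℝ), 0 < p.2 :=
    tendsto_snd.eventually self_mem_nhdsWithin
  have h1 : ∀ᶠ p : EuclideanSpace ℝ (Fin d) × ℝ in 𝓝 x ×ˢ 𝓝[>] (0 : ℝ), p.1 ∈ t :=
    tendsto_fst.eventually ht
  have h2 : ∀ᶠ p : EuclideanSpace ℝ (Fin d) × ℝ in 𝓝 x ×ˢ 𝓝[>] (0 : ℝ), p.1 + p.2 • v ∈ t := by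
    have hc : Tendsto (fun p : EuclideanSpace ℝ (Fin d) × ℝ => p.1 + p.2 • v) (𝓝 (x, 0))
        (𝓝 (x + (0 : ℝ) • v)) :=
      (show Continuous fun p : EuclideanSpace ℝ (Fin d) × ℝ => p.1 + p.2 • v by
        fun_prop).tendsto _
    rw [zero_smul, add_zero, nhds_prod_eq] at hc
    exact (hc.mono_left (prod_mono_right _ nhdsWithin_le_nhds)).eventually ht
  filter_upwards [h0, h1, h2] with p hp hp1 hp2
  rw [div_le_iff₀ hp]
  have := (le_abs_self _).trans (hK.norm_sub_le hp2 hp1)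
  rw [add_sub_cancel_left, norm_smul, Real.norm_of_nonneg hp.le] at this
  linarith

theorem LocallyLipschitz.inner_le_genDirDeriv (hf : LocallyLipschitz f)
    {x ζ : EuclideanSpace ℝ (Fin d)} (v : EuclideanSpace ℝ (Fin d))
    (hζ : ζ ∈ closure (generalizedGradient f x)) : inner ℝ ζ v ≤ genDirDeriv f x v := by
  have hcv : Convex ℝ {ζ : EuclideanSpace ℝ (Fin d) | inner ℝ ζ v ≤ genDirDeriv f x v} :=
    convex_halfSpace_le
      ⟨fun a b => inner_add_left a b v, fun c a => real_inner_smul_left a v c⟩ _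
  have hcl : IsClosed {ζ : EuclideanSpace ℝ (Fin d) | inner ℝ ζ v ≤ genDirDeriv f x v} :=
    isClosed_le (by fun_prop) continuous_const
  refine closure_minimal (convexHull_min ?_ hcv) hcl hζ
  rintro ξ ⟨u, hu, hd, hg⟩
  obtain ⟨C, hC⟩ := hf.exists_differenceQuotient_le x v
  change inner ℝ ξ v ≤ genDirDeriv f x v
  refine le_of_forall_lt fun c hc => ?_
  obtain ⟨c', hcc', hc'⟩ := exists_between hc
  refine hcc'.trans_le (le_limsup_of_frequently_le ?_ ⟨C, hC⟩)
  -- near each `u i`, small difference quotients in the direction `v` exceed `c'`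
  have hlim : Tendsto (fun i => inner ℝ (gradient f (u i)) v) atTop (𝓝 (inner ℝ ξ v)) :=
    hg.inner tendsto_const_nhds
  rw [frequently_iff]
  intro U hU
  obtain ⟨A, hA, B, hB, hAB⟩ := mem_prod_iff.1 hU
  obtain ⟨i, hi1, hi2⟩ := ((hlim.eventually (lt_mem_nhds hc')).and (hu.eventually hA)).exists
  rw [inner_gradient_left] at hi1
  have hder := ((hd i).hasFDerivAt.hasLineDerivAt v).tendsto_slope_zero_right
  obtain ⟨h, hh1, hh2⟩ := ((hder.eventually (lt_mem_nhds hi1)).and hB).exists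
  refine ⟨(u i, h), hAB ⟨hi2, hh2⟩, ?_⟩
  rw [smul_eq_mul, inv_mul_eq_div] at hh1
  exact hh1.le

theorem IsRegularFunctionAt.genDirDeriv_eq_of_tendsto {x v : EuclideanSpace ℝ (Fin d)}
    (h : IsRegularFunctionAt f x) {l : ℝ}
    (hl : Tendsto (fun h : ℝ => (f (x + h • v) - f x) / h) (𝓝[>] 0) (𝓝 l)) :
    genDirDeriv f x v = l :=
  tendsto_nhds_unique (h v) hl

/-- A regular function has, at a point of differentiability, only one generalized gradient. -/
theorem IsRegularFunctionAt.nonsmoothGradientField_eq (hf : LocallyLipschitz f)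
    {x : EuclideanSpace ℝ (Fin d)} (h : IsRegularFunctionAt f x)
    (hd : DifferentiableAt ℝ f x) : nonsmoothGradientField f x = -gradient f x := by
  set ζ := -nonsmoothGradientField f x with hζdef
  have hζ : ζ ∈ closure (generalizedGradient f x) :=
    (hf.neg_nonsmoothGradientField_mem_leastNormSet x).1
  have hg : genDirDeriv f x (ζ - gradient f x) = inner ℝ (gradient f x) (ζ - gradient f x) := by
    refine h.genDirDeriv_eq_of_tendsto ?_
    rw [inner_gradient_left]
    simpa only [smul_eq_mul, inv_mul_eq_div] using
      (hd.hasFDerivAt.hasLineDerivAt (ζ - gradient f x)).tendsto_slope_zero_right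
  have hle := hf.inner_le_genDirDeriv (ζ - gradient f x) hζ
  rw [hg, ← sub_nonpos, ← inner_sub_left, real_inner_self_nonpos, sub_eq_zero] at hle
  rw [← hle, hζdef, neg_neg]

theorem LocallyLipschitz.nonsmoothGradientField_ae_eq (hf : LocallyLipschitz f)
    (hreg : ∀ x, IsRegularFunctionAt f x) :
    ∀ᵐ y, DifferentiableAt ℝ f y ∧ nonsmoothGradientField f y = -gradient f y := by
  filter_upwards [hf.ae_differentiableAt_real (μ := volume)] with y hy
  exact ⟨hy, (hreg y).nonsmoothGradientField_eq hf hy⟩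

theorem LocallyLipschitz.aestronglyMeasurable_nonsmoothGradientField (hf : LocallyLipschitz f)
    (hreg : ∀ x, IsRegularFunctionAt f x) :
    AEStronglyMeasurable (nonsmoothGradientField f) volume := by
  have hm : Measurable fun y => -gradient f y := by
    have : Measurable fun y => (InnerProductSpace.toDual ℝ (EuclideanSpace ℝ (Fin d))).symm
        (fderiv ℝ f y) :=
      (LinearIsometryEquiv.continuous _).measurable.comp (measurable_fderiv ℝ f)
    exact this.neg
  refine hm.aestronglyMeasurable.congr ?_
  filter_upwards [hf.nonsmoothGradientField_ae_eq hreg] with y hy using hy.2.symm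

/-- A local minimizer is an equilibrium of the Filippov inclusion. Otherwise a direction
separates `0` from almost all values of the field near `xe`, and `f` would decrease linearly
along it. -/
theorem LocallyLipschitz.zero_mem_filippovMap (hf : LocallyLipschitz f)
    (hreg : ∀ x, IsRegularFunctionAt f x) {xe : EuclideanSpace ℝ (Fin d)}
    (hmin : IsLocalMin f xe) : 0 ∈ filippovMap (nonsmoothGradientField f) xe := by
  simp only [filippovMap, Set.mem_iInter]
  intro δ hδ S hS
  by_contra hmem
  obtain ⟨l, c, hlc, hl⟩ := geometric_hahn_banach_point_closed
    (convex_convexHull ℝ _).closure isClosed_closure hmem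
  rw [map_zero] at hlc
  obtain ⟨v, rfl⟩ := (InnerProductSpace.toDual ℝ (EuclideanSpace ℝ (Fin d))).surjective l
  obtain ⟨K, t, ht, hK⟩ := hf xe
  obtain ⟨r, hr, hrt⟩ := Metric.mem_nhds_iff.1 (inter_mem ht (Metric.ball_mem_nhds xe hδ))
  have hdec : ∀ᵐ y, y ∈ Metric.ball xe r → DifferentiableAt ℝ f y ∧ fderiv ℝ f y v ≤ -c := by
    filter_upwards [hf.nonsmoothGradientField_ae_eq hreg,
      measure_eq_zero_iff_ae_notMem.1 hS] with y hy hyS hyr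
    refine ⟨hy.1, ?_⟩
    have := hl _ (subset_closure (subset_convexHull ℝ _ ⟨y, ⟨(hrt hyr).2, hyS⟩, rfl⟩))
    rw [hy.2, InnerProductSpace.toDual_apply_apply, inner_neg_right, real_inner_comm,
      inner_gradient_left] at this
    linarith
  have hKr : LipschitzOnWith K f (Metric.ball xe r) := hK.mono fun y hy => (hrt hy).1
  have hcont : Tendsto (fun h : ℝ => xe + h • v) (𝓝[>] 0) (𝓝 xe) := by
    have : Tendsto (fun h : ℝ => xe + h • v) (𝓝 0) (𝓝 (xe + (0 : ℝ) • v)) :=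
      (show Continuous fun h : ℝ => xe + h • v by fun_prop).tendsto _
    rw [zero_smul, add_zero] at this
    exact this.mono_left nhdsWithin_le_nhds
  obtain ⟨h, ⟨h1, h2⟩, h3⟩ := (((hcont.eventually hmin).and
    (hcont.eventually (Metric.ball_mem_nhds xe hr))).and
      (self_mem_nhdsWithin : Set.Ioi (0 : ℝ) ∈ 𝓝[>] 0)).exists
  have h4 := hKr.sub_le_mul_of_ae_fderiv_le hdec h3.le (Metric.mem_ball_self hr) h2
  have h5 : 0 < c * h := mul_pos hlc h3
  linarith

theorem LocallyLipschitz.nonsmoothGradientField_eq_zero (hf : LocallyLipschitz f)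
    {x : EuclideanSpace ℝ (Fin d)} (h : 0 ∈ filippovMap (nonsmoothGradientField f) x) :
    nonsmoothGradientField f x = 0 := by
  have h1 := hf.neg_mem_closure_generalizedGradient h
  have h2 := (hf.neg_nonsmoothGradientField_mem_leastNormSet x).2 _ h1
  simpa using h2

/-- One-sided difference quotients along a differentiable curve agree with those along its
tangent line. -/
theorem LocallyLipschitz.tendsto_slope_comp_of_hasDerivAt (hf : LocallyLipschitz f)
    {x : ℝ → EuclideanSpace ℝ (Fin d)} {v : EuclideanSpace ℝ (Fin d)} {t : ℝ}
    (hx : HasDerivAt x v t) :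
    Tendsto (fun h : ℝ => (f (x (t + h)) - f (x t + h • v)) / h) (𝓝 0) (𝓝 0) := by
  obtain ⟨K, s, hs, hK⟩ := hf (x t)
  have h1 : ∀ᶠ h in 𝓝 (0 : ℝ), x (t + h) ∈ s := by
    have : Tendsto (fun h : ℝ => x (t + h)) (𝓝 0) (𝓝 (x t)) := by
      have h0 : ContinuousAt (fun h : ℝ => x (t + h)) 0 :=
        ContinuousAt.comp (f := fun h : ℝ => t + h) (g := x)
          (by simpa using hx.continuousAt) (by fun_prop)
      simpa [ContinuousAt] using h0
    exact this hs
  have h2 : ∀ᶠ h in 𝓝 (0 : ℝ), x t + h • v ∈ s := by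
    have : Tendsto (fun h : ℝ => x t + h • v) (𝓝 0) (𝓝 (x t + (0 : ℝ) • v)) :=
      (show Continuous fun h : ℝ => x t + h • v by fun_prop).tendsto _
    rw [zero_smul, add_zero] at this
    exact this hs
  have h3 := hasDerivAt_iff_isLittleO_nhds_zero.1 hx
  have h4 : (fun h : ℝ => f (x (t + h)) - f (x t + h • v)) =O[𝓝 0]
      fun h => x (t + h) - x t - h • v := by
    refine Asymptotics.IsBigO.of_bound K ?_
    filter_upwards [h1, h2] with h hh1 hh2
    simpa [sub_sub] using hK.norm_sub_le hh1 hh2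
  exact (h4.trans_isLittleO h3).tendsto_div_nhds_zero

/-- The chain rule along a curve for a regular function: the derivative of `f ∘ x` is the inner
product of the velocity with every generalized gradient. Regularity identifies the right
derivative with `f°(x; v)` and the left derivative with `-f°(x; -v)`, which bound this inner
product from above and from below. -/
theorem LocallyLipschitz.deriv_comp_eq_inner (hf : LocallyLipschitz f)
    {x : ℝ → EuclideanSpace ℝ (Fin d)} {v ζ : EuclideanSpace ℝ (Fin d)} {t : ℝ}
    (hreg : IsRegularFunctionAt f (x t)) (hx : HasDerivAt x v t)
    (hfx : DifferentiableAt ℝ (f ∘ x) t) (hζ : ζ ∈ closure (generalizedGradient f (x t))) :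
    deriv (f ∘ x) t = inner ℝ ζ v := by
  have hD := hfx.hasDerivAt
  have hline := hf.tendsto_slope_comp_of_hasDerivAt hx
  have hright : genDirDeriv f (x t) v = deriv (f ∘ x) t := by
    refine hreg.genDirDeriv_eq_of_tendsto ?_
    have := hD.tendsto_slope_zero_right.sub (hline.mono_left nhdsWithin_le_nhds)
    rw [sub_zero] at this
    refine this.congr fun h => ?_
    simp only [Function.comp_apply, smul_eq_mul]
    ring
  have hleft : genDirDeriv f (x t) (-v) = -deriv (f ∘ x) t := by
    refine hreg.genDirDeriv_eq_of_tendsto ?_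
    have h1 := (hD.tendsto_slope_zero_left.sub (hline.mono_left nhdsWithin_le_nhds)).neg
    rw [sub_zero] at h1
    have h2 : Tendsto (fun h : ℝ => -h) (𝓝[>] 0) (𝓝[<] 0) := by
      simpa using tendsto_neg_nhdsGT (a := (0 : ℝ))
    refine (h1.comp h2).congr fun h => ?_
    simp only [Function.comp_apply, smul_eq_mul, smul_neg, neg_smul]
    rw [inv_neg, div_neg, div_eq_mul_inv, div_eq_mul_inv]
    ring
  have h1 := hf.inner_le_genDirDeriv v hζ
  have h2 := hf.inner_le_genDirDeriv (-v) hζ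
  rw [inner_neg_right] at h2
  linarith

end DirectionalDerivative

section Solutions

variable {d : ℕ} {f : EuclideanSpace ℝ (Fin d) → ℝ}

/-! ### Solutions of differential inclusions and their continuation -/

namespace IsInclusionSolution

variable {F : EuclideanSpace ℝ (Fin d) → Set (EuclideanSpace ℝ (Fin d))} {I : Set ℝ}
  {x : ℝ → EuclideanSpace ℝ (Fin d)}

theorem zero_mem (h : IsInclusionSolution F I x) : (0 : ℝ) ∈ I := h.isLeast_zero.1

theorem nonneg (h : IsInclusionSolution F I x) {t : ℝ} (ht : t ∈ I) : 0 ≤ t := h.isLeast_zero.2 ht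

theorem Icc_subset (h : IsInclusionSolution F I x) {b : ℝ} (hb : b ∈ I) : Set.Icc 0 b ⊆ I :=
  h.ordConnected.out h.zero_mem hb

theorem ae_deriv_mem (h : IsInclusionSolution F I x) :
    ∀ᵐ t, t ∈ I → ∃ v ∈ F (x t), HasDerivAt x v t :=
  (ae_restrict_iff' h.ordConnected.measurableSet).1 h.deriv_mem

theorem absolutelyContinuous_of_le (h : IsInclusionSolution F I x) {a b : ℝ} (ha : a ∈ I)
    (hb : b ∈ I) (hab : a ≤ b) : AbsolutelyContinuousOnInterval x a b := by
  refine (h.absolutelyContinuous b hb).mono ?_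
  rw [Set.uIcc_of_le hab, Set.uIcc_of_le (h.nonneg hb)]
  exact Set.Icc_subset_Icc_left (h.nonneg ha)

theorem lipschitzOnWith (h : IsInclusionSolution F I x) {M : NNReal}
    (hM : ∀ t ∈ I, ∀ v ∈ F (x t), ‖v‖ ≤ M) : LipschitzOnWith M x I := by
  have key : ∀ a ∈ I, ∀ b ∈ I, a ≤ b → dist (x a) (x b) ≤ M * dist a b := by
    intro a ha b hb hab
    rw [dist_comm, dist_eq_norm, dist_comm a b, Real.dist_eq, abs_of_nonneg (sub_nonneg.2 hab)]
    refine (h.absolutelyContinuous_of_le ha hb hab).norm_sub_le_of_norm_deriv_le hab ?_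
    filter_upwards [h.ae_deriv_mem] with t ht hmt
    have htI := h.ordConnected.out ha hb ⟨hmt.1.le, hmt.2.le⟩
    obtain ⟨v, hv, hd⟩ := ht htI
    exact ⟨v, hM t htI v hv, hd⟩
  refine LipschitzOnWith.of_dist_le_mul fun a ha b hb => ?_
  rcases le_total a b with hab | hab
  · exact key a ha b hb hab
  · rw [dist_comm, dist_comm a b]
    exact key b hb a ha hab

theorem eq_Ici (h : IsInclusionSolution F I x) (hI : ¬ BddAbove I) : I = Set.Ici 0 := by
  refine Set.Subset.antisymm (fun t ht => h.nonneg ht) fun t ht => ?_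
  obtain ⟨s, hs, hts⟩ := not_bddAbove_iff.1 hI t
  exact h.Icc_subset hs ⟨ht, hts.le⟩

end IsInclusionSolution

/-- The concatenation of two Lipschitz curves that meet at time `T`. -/
theorem LipschitzWith.ite_le {E : Type*} [PseudoMetricSpace E] {y z : ℝ → E} {K : NNReal} {T : ℝ}
    (hy : LipschitzWith K y) (hz : LipschitzWith K z) (hyz : y T = z T) :
    LipschitzWith K fun t => if t ≤ T then y t else z t := by
  have key : ∀ s t, s ≤ T → T < t → dist (y s) (z t) ≤ K * dist s t := by
    intro s t hs ht
    have h1 := hy.dist_le_mul s T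
    have h2 := hz.dist_le_mul T t
    have h3 := dist_triangle (y s) (y T) (z t)
    rw [Real.dist_eq, abs_of_nonpos (by linarith)] at h1 h2 ⊢
    rw [hyz] at h1 h3
    linarith
  refine LipschitzWith.of_dist_le_mul fun s t => ?_
  rcases le_or_gt s T with hs | hs <;> rcases le_or_gt t T with ht | ht
  · simpa [hs, ht] using hy.dist_le_mul s t
  · simpa [hs, ht.not_ge] using key s t hs ht
  · rw [dist_comm, dist_comm s t]
    simpa [ht, hs.not_ge] using key t s ht hs
  · simpa [hs.not_ge, ht.not_ge] using hz.dist_le_mul s t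

/-- A maximal Filippov solution of a measurable, locally bounded vector field that is Lipschitz on
its interval of definition exists for all times: otherwise it extends to the end point `T` of this
interval, and a solution starting there continues it beyond `T`. -/
theorem IsMaximalInclusionSolution.eq_Ici_of_lipschitzOnWith
    {X : EuclideanSpace ℝ (Fin d) → EuclideanSpace ℝ (Fin d)}
    (hX : AEStronglyMeasurable X volume)
    (hXb : ∀ p, ∃ M : NNReal, ∀ᶠ y in 𝓝 p, ‖X y‖ ≤ M) {I : Set ℝ}
    {x : ℝ → EuclideanSpace ℝ (Fin d)} (h : IsMaximalInclusionSolution (filippovMap X) I x)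
    {K : NNReal} (hK : LipschitzOnWith K x I) : I = Set.Ici 0 := by
  obtain ⟨hsol, hmax⟩ := h
  refine hsol.eq_Ici fun hbdd => ?_
  set T := sSup I with hT
  have hIT : ∀ t ∈ I, t ≤ T := fun t ht => le_csSup hbdd ht
  have hTpos : 0 < T := by
    obtain ⟨s, hs, hs0⟩ := hsol.nontrivial.exists_ne 0
    exact (lt_of_le_of_ne (hsol.nonneg hs) (Ne.symm hs0)).trans_le (hIT s hs)
  have hIoo : Set.Ioo 0 T ⊆ I := fun t ht => by
    obtain ⟨s, hs, hts⟩ := exists_lt_of_lt_csSup ⟨0, hsol.zero_mem⟩ ht.2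
    exact hsol.Icc_subset hs ⟨ht.1.le, hts.le⟩
  obtain ⟨y, hyL, hxy⟩ := hK.extend_finite_dimension
  obtain ⟨M, hM⟩ := hXb (y T)
  obtain ⟨R, hR, hball⟩ := Metric.eventually_nhds_iff_ball.1 hM
  obtain ⟨τ, hτ, z, hz0, hzL, hz⟩ := exists_filippov_solution hX hR hball
  have hz' : LipschitzWith M fun t => z (t - T) :=
    LipschitzWith.of_dist_le_mul fun s t => by
      simpa using hzL.dist_le_mul (s - T) (t - T)
  set w : ℝ → EuclideanSpace ℝ (Fin d) := fun t => if t ≤ T then y t else z (t - T) with hw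
  have hwL := LipschitzWith.ite_le (T := T) (hyL.weaken (le_max_left _ M))
    (hz'.weaken (le_max_right _ M)) (by simp [hz0])
  have hxw : Set.EqOn x w I := fun t ht => by
    simp only [hw, if_pos (hIT t ht)]
    exact hxy ht
  have hT0 : 0 < T + τ := add_pos hTpos hτ
  have hwsol : IsInclusionSolution (filippovMap X) (Set.Icc 0 (T + τ)) w := by
    refine ⟨isLeast_Icc hT0.le, Set.ordConnected_Icc,
      ⟨0, Set.left_mem_Icc.2 hT0.le, _, Set.right_mem_Icc.2 hT0.le, hT0.ne⟩,
      fun b _ => hwL.lipschitzOnWith.absolutelyContinuousOnInterval, ?_⟩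
    refine (ae_restrict_iff' measurableSet_Icc).2 ?_
    filter_upwards [hsol.ae_deriv_mem,
      (measurePreserving_sub_right volume T).quasiMeasurePreserving.ae hz,
      Measure.ae_ne volume (0 : ℝ), Measure.ae_ne volume T, Measure.ae_ne volume (T + τ)]
      with t h1 h2 h3 h4 h5 ht
    rcases lt_or_gt_of_ne h4 with htT | htT
    · have hmem : t ∈ Set.Ioo 0 T := ⟨lt_of_le_of_ne ht.1 (Ne.symm h3), htT⟩
      obtain ⟨v, hv, hd⟩ := h1 (hIoo hmem)
      have heq : w =ᶠ[𝓝 t] x := by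
        filter_upwards [Ioo_mem_nhds hmem.1 hmem.2] with s hs using (hxw (hIoo hs)).symm
      exact ⟨v, by rwa [heq.eq_of_nhds], heq.hasDerivAt_iff.2 hd⟩
    · obtain ⟨v, hv, hd⟩ := h2 ⟨sub_pos.2 htT, by
        have := lt_of_le_of_ne ht.2 h5
        linarith⟩
      have heq : w =ᶠ[𝓝 t] fun s => z (s - T) := by
        filter_upwards [Ioi_mem_nhds htT] with s hs
        simp only [hw, if_neg (not_le.2 (Set.mem_Ioi.1 hs))]
      exact ⟨v, by rwa [heq.eq_of_nhds], heq.hasDerivAt_iff.2 (hd.comp_sub_const t T)⟩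
  have hJ := hmax _ w hwsol (fun t ht => ⟨hsol.nonneg ht, (hIT t ht).trans (by linarith)⟩) hxw
  have := hIT (T + τ) (hJ ▸ Set.right_mem_Icc.2 hT0.le)
  linarith

/-! ### The nonsmooth gradient flow -/

theorem LocallyLipschitz.exists_lipschitzOnWith_of_isInclusionSolution (hf : LocallyLipschitz f)
    {I : Set ℝ} {x : ℝ → EuclideanSpace ℝ (Fin d)}
    (h : IsInclusionSolution (filippovMap (nonsmoothGradientField f)) I x)
    {C : Set (EuclideanSpace ℝ (Fin d))} (hC : IsCompact C) (hxC : ∀ t ∈ I, x t ∈ C) :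
    ∃ K : NNReal, LipschitzOnWith K x I := by
  obtain ⟨K, hK⟩ := hf.exists_norm_le_of_mem_closure_generalizedGradient hC
  refine ⟨K, h.lipschitzOnWith fun t ht v hv => ?_⟩
  simpa using hK _ (hxC t ht) _ (hf.neg_mem_closure_generalizedGradient hv)

theorem LocallyLipschitz.eq_Ici_of_isMaximalInclusionSolution (hf : LocallyLipschitz f)
    (hreg : ∀ x, IsRegularFunctionAt f x) {I : Set ℝ} {x : ℝ → EuclideanSpace ℝ (Fin d)}
    (h : IsMaximalInclusionSolution (filippovMap (nonsmoothGradientField f)) I x)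
    {C : Set (EuclideanSpace ℝ (Fin d))} (hC : IsCompact C) (hxC : ∀ t ∈ I, x t ∈ C) :
    I = Set.Ici 0 := by
  obtain ⟨K, hK⟩ := hf.exists_lipschitzOnWith_of_isInclusionSolution h.1 hC hxC
  refine h.eq_Ici_of_lipschitzOnWith (hf.aestronglyMeasurable_nonsmoothGradientField hreg)
    (fun p => ?_) hK
  obtain ⟨M, hM⟩ := hf.exists_norm_le_of_mem_closure_generalizedGradient_nhds p
  refine ⟨M, hM.mono fun y hy => ?_⟩
  simpa using hy _ (hf.neg_nonsmoothGradientField_mem_leastNormSet y).1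

/-- Energy dissipation: where generalized gradients have norm at least `c`, the value of `f`
decreases along solutions at rate at least `c ^ 2`. By the chain rule, applied with the
generalized gradient `-v`, the derivative of `f ∘ x` at a time with velocity `v` is `-‖v‖ ^ 2`. -/
theorem LocallyLipschitz.sub_le_of_isInclusionSolution (hf : LocallyLipschitz f)
    (hreg : ∀ x, IsRegularFunctionAt f x) {I : Set ℝ} {x : ℝ → EuclideanSpace ℝ (Fin d)}
    (h : IsInclusionSolution (filippovMap (nonsmoothGradientField f)) I x) {a b c : ℝ}
    (ha : a ∈ I) (hb : b ∈ I) (hab : a ≤ b) (hc : 0 ≤ c)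
    (hxc : ∀ t ∈ Set.Icc a b, ∀ ζ ∈ closure (generalizedGradient f (x t)), c ≤ ‖ζ‖) :
    f (x b) - f (x a) ≤ -c ^ 2 * (b - a) := by
  have hac := h.absolutelyContinuous_of_le ha hb hab
  have hcomp : IsCompact (x '' Set.uIcc a b) :=
    isCompact_uIcc.image_of_continuousOn hac.continuousOn
  obtain ⟨K, hK⟩ :=
    (hf.locallyLipschitzOn (s := x '' Set.uIcc a b)).exists_lipschitzOnWith_of_compact hcomp
  have hfac : AbsolutelyContinuousOnInterval (f ∘ x) a b :=
    hK.comp_absolutelyContinuousOnInterval hac (Set.mapsTo_image _ _)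
  refine hfac.sub_le_mul_of_deriv_le hab ?_
  filter_upwards [h.ae_deriv_mem, hfac.ae_differentiableAt] with t h1 h2 ht
  have htab : t ∈ Set.Icc a b := ⟨ht.1.le, ht.2.le⟩
  obtain ⟨v, hv, hd⟩ := h1 (h.ordConnected.out ha hb htab)
  have hζ := hf.neg_mem_closure_generalizedGradient hv
  rw [hf.deriv_comp_eq_inner (hreg _) hd (h2 (by rwa [Set.uIcc_of_le hab])) hζ, inner_neg_left,
    real_inner_self_eq_norm_sq]
  have := hxc t htab _ hζ
  rw [norm_neg] at this
  nlinarith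

theorem LocallyLipschitz.le_of_isInclusionSolution (hf : LocallyLipschitz f)
    (hreg : ∀ x, IsRegularFunctionAt f x) {I : Set ℝ} {x : ℝ → EuclideanSpace ℝ (Fin d)}
    (h : IsInclusionSolution (filippovMap (nonsmoothGradientField f)) I x) {a b : ℝ}
    (ha : a ∈ I) (hb : b ∈ I) (hab : a ≤ b) : f (x b) ≤ f (x a) := by
  have := hf.sub_le_of_isInclusionSolution hreg h ha hb hab le_rfl fun _ _ ζ _ => norm_nonneg ζ
  simpa using this

/-- Lyapunov's argument: a solution that starts where `f` is smaller than its minimum on the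
sphere of radius `ρ` around `xe` cannot cross that sphere. -/
theorem LocallyLipschitz.isStronglyStableEquilibrium (hf : LocallyLipschitz f)
    (hreg : ∀ x, IsRegularFunctionAt f x) {xe : EuclideanSpace ℝ (Fin d)}
    (hmin : ∀ᶠ y in 𝓝[≠] xe, f xe < f y) :
    IsStronglyStableEquilibrium (filippovMap (nonsmoothGradientField f)) xe := by
  have hloc : IsLocalMin f xe := by
    filter_upwards [eventually_nhdsWithin_iff.1 hmin] with y hy
    by_cases hyx : y = xe
    · rw [hyx]
    · exact (hy hyx).le
  refine ⟨hf.zero_mem_filippovMap hreg hloc, fun ε hε => ?_⟩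
  obtain ⟨r, hr, hball⟩ := Metric.eventually_nhds_iff_ball.1 (eventually_nhdsWithin_iff.1 hmin)
  obtain ⟨ρ, hρ, hρr, hρε⟩ : ∃ ρ > 0, ρ < r ∧ ρ < ε :=
    ⟨min r ε / 2, by positivity, by linarith [min_le_left r ε, lt_min hr hε],
      by linarith [min_le_right r ε, lt_min hr hε]⟩
  obtain ⟨m, hm, hsphere⟩ : ∃ m, f xe < m ∧ ∀ y ∈ Metric.sphere xe ρ, m ≤ f y := by
    -- the sphere is empty when `d = 0`
    rcases (Metric.sphere xe ρ).eq_empty_or_nonempty with he | hne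
    · exact ⟨f xe + 1, by linarith, by simp [he]⟩
    · obtain ⟨p, hp, hpmin⟩ := (isCompact_sphere xe ρ).exists_isMinOn hne
        hf.continuous.continuousOn
      refine ⟨f p, hball p ?_ ?_, fun y hy => hpmin hy⟩
      · rw [Metric.mem_ball, Metric.mem_sphere.1 hp]; exact hρr
      · exact Metric.ne_of_mem_sphere hp hρ.ne'
  obtain ⟨δ, hδ, hδball⟩ := Metric.mem_nhds_iff.1
    (inter_mem (hf.continuous.continuousAt.eventually (gt_mem_nhds hm))
      (Metric.ball_mem_nhds xe hρ))
  refine ⟨δ, hδ, fun I x hsol hx0 => ?_⟩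
  obtain ⟨hfx0, hx0ρ⟩ := hδball (Metric.mem_ball.2 hx0)
  have hstay : ∀ t ∈ I, dist (x t) xe < ρ := by
    intro t ht
    by_contra! hge
    have hcont : ContinuousOn (fun s => dist (x s) xe) (Set.Icc 0 t) := by
      have := (hsol.absolutelyContinuous t ht).continuousOn
      rw [Set.uIcc_of_le (hsol.nonneg ht)] at this
      exact (continuous_id.dist continuous_const).comp_continuousOn this
    obtain ⟨s, hs, hsρ⟩ := intermediate_value_Icc (hsol.nonneg ht) hcont
      ⟨(Metric.mem_ball.1 hx0ρ).le, hge⟩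
    have h1 := hsphere (x s) hsρ
    have h2 := hf.le_of_isInclusionSolution hreg hsol hsol.zero_mem (hsol.Icc_subset ht hs) hs.1
    have h3 : f (x 0) < m := hfx0
    linarith
  exact ⟨fun t ht => (hstay t ht).trans hρε, fun hmax =>
    hf.eq_Ici_of_isMaximalInclusionSolution hreg hmax (isCompact_closedBall xe ρ)
      fun t ht => (hstay t ht).le⟩

/-- LaSalle's argument: whenever the solution is at distance more than `ε` from the critical set,
it stays at distance at least `ε / 2` for a fixed time and so `f` decreases by a fixed amount, while
the total decrease of `f` is finite. -/
theorem LocallyLipschitz.tendsto_infEDist_criticalSet (hf : LocallyLipschitz f)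
    (hreg : ∀ x, IsRegularFunctionAt f x) {x : ℝ → EuclideanSpace ℝ (Fin d)}
    (h : IsInclusionSolution (filippovMap (nonsmoothGradientField f)) (Set.Ici 0) x)
    {C : Set (EuclideanSpace ℝ (Fin d))} (hC : IsCompact C) (hxC : ∀ t ∈ Set.Ici (0 : ℝ), x t ∈ C) :
    Tendsto (fun t => Metric.infEDist (x t) (criticalSet f)) atTop (𝓝 0) := by
  obtain ⟨K, hK⟩ := hf.exists_lipschitzOnWith_of_isInclusionSolution h hC hxC
  -- `f ∘ x` is controlled on `[0, ∞)` only, hence the truncation `max t 0`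
  have hanti : Antitone fun t : ℝ => f (x (max t 0)) := fun s t hst =>
    hf.le_of_isInclusionSolution hreg h (Set.mem_Ici.2 (le_max_right _ _))
      (Set.mem_Ici.2 (le_max_right _ _)) (max_le_max_right 0 hst)
  have hbdd : BddBelow (Set.range fun t : ℝ => f (x (max t 0))) :=
    (hC.image hf.continuous).bddBelow.mono (by
      rintro _ ⟨t, rfl⟩
      exact ⟨_, hxC _ (Set.mem_Ici.2 (le_max_right _ _)), rfl⟩)
  have hlim := tendsto_atTop_ciInf hanti hbdd
  rw [ENNReal.tendsto_nhds_zero]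
  intro ε hε
  obtain ⟨e, he0, heε⟩ := ENNReal.lt_iff_exists_nnreal_btwn.1 hε
  have he : 0 < e := by exact_mod_cast he0
  have hdisj : Disjoint (C ∩ {y | ((e / 2 : NNReal) : ENNReal) ≤ Metric.infEDist y (criticalSet f)})
      (criticalSet f) := by
    rw [Set.disjoint_left]
    rintro y ⟨-, hy⟩ hyc
    rw [Set.mem_ofPred_eq, Metric.infEDist_zero_of_mem hyc] at hy
    have : e / 2 ≤ 0 := by exact_mod_cast hy
    exact absurd this (not_le.2 (half_pos he))
  obtain ⟨c, hc, hcle⟩ := hf.exists_le_norm_of_disjoint_criticalSet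
    (hC.inter_right (isClosed_le continuous_const Metric.continuous_infEDist)) hdisj
  -- in time `η` the solution moves by at most `e / 2`
  set η : NNReal := e / (2 * (K + 1)) with hη
  have hηpos : 0 < η := by positivity
  have hKη : K * η ≤ e / 2 := by
    rw [hη, mul_div_assoc', div_le_div_iff₀ (by positivity) (by positivity)]
    nlinarith [he.le, K.2]
  -- `f ∘ x` converges, so its increments over time `η` tend to zero
  have hdrop : ∀ᶠ t : ℝ in atTop, -c ^ 2 * η < f (x (max (t + η) 0)) - f (x (max t 0)) := by
    have := (hlim.comp (tendsto_atTop_add_const_right _ (η : ℝ) tendsto_id)).sub hlim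
    rw [sub_self] at this
    refine this.eventually (lt_mem_nhds ?_)
    have : 0 < c ^ 2 * η := by positivity
    linarith
  filter_upwards [hdrop, eventually_ge_atTop 0] with t ht ht0
  refine le_trans ?_ heε.le
  by_contra! hgt
  have htη : t ≤ t + η := le_add_of_nonneg_right η.2
  rw [max_eq_left ht0, max_eq_left (ht0.trans htη)] at ht
  have hdec := hf.sub_le_of_isInclusionSolution hreg h ht0 (ht0.trans htη : (0 : ℝ) ≤ t + η) htη
    hc.le fun s hs => hcle _ ⟨hxC s (ht0.trans hs.1), by
      have h1 : Metric.infEDist (x t) (criticalSet f) ≤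
          edist (x t) (x s) + Metric.infEDist (x s) (criticalSet f) :=
        Metric.infEDist_le_edist_add_infEDist
      have h2 : edist (x t) (x s) ≤ ((e / 2 : NNReal) : ENNReal) := by
        rw [edist_nndist, ENNReal.coe_le_coe]
        refine le_trans (NNReal.coe_le_coe.1 ?_) hKη
        have h3 := hK.dist_le_mul t ht0 s (ht0.trans hs.1)
        rw [Real.dist_eq, abs_sub_comm, abs_of_nonneg (sub_nonneg.2 hs.1)] at h3
        refine h3.trans ?_
        push_cast
        exact mul_le_mul_of_nonneg_left (by linarith [hs.2]) K.2
      refine Set.mem_ofPred_eq ▸ not_lt.1 fun hlt => ?_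
      have h4 := hgt.trans_le (h1.trans (add_le_add h2 hlt.le))
      rw [← ENNReal.coe_add, add_halves] at h4
      exact lt_irrefl _ h4⟩
  rw [add_sub_cancel_left] at hdec
  linarith

end Solutions

theorem mainTheorem1 {d : ℕ} (f : EuclideanSpace ℝ (Fin d) → ℝ)
    (hLip : LocallyLipschitz f) (hreg : ∀ x, IsRegularFunctionAt f x) :
    (∀ xe : EuclideanSpace ℝ (Fin d), (∀ᶠ y in 𝓝[≠] xe, f xe < f y) →
      nonsmoothGradientField f xe = 0 ∧
        IsStronglyStableEquilibrium (filippovMap (nonsmoothGradientField f)) xe) ∧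
    ((∀ x : EuclideanSpace ℝ (Fin d), Bornology.IsBounded {y | f y ≤ f x}) →
      ∀ (I : Set ℝ) (x : ℝ → EuclideanSpace ℝ (Fin d)),
        IsMaximalInclusionSolution (filippovMap (nonsmoothGradientField f)) I x →
          I = Set.Ici 0 ∧
            Tendsto (fun t => Metric.infEDist (x t) (criticalSet f)) atTop (𝓝 0)) := by
  refine ⟨fun xe hmin => ?_, fun hbdd I x hmax => ?_⟩
  · have hstable := hLip.isStronglyStableEquilibrium hreg hmin
    exact ⟨hLip.nonsmoothGradientField_eq_zero hstable.1, hstable⟩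
  · have hC : IsCompact {y | f y ≤ f (x 0)} :=
      Metric.isCompact_of_isClosed_isBounded (isClosed_le hLip.continuous continuous_const)
        (hbdd (x 0))
    have hxC : ∀ t ∈ I, x t ∈ {y | f y ≤ f (x 0)} := fun t ht =>
      hLip.le_of_isInclusionSolution hreg hmax.1 hmax.1.zero_mem ht (hmax.1.nonneg ht)
    obtain rfl := hLip.eq_Ici_of_isMaximalInclusionSolution hreg hmax hC hxC
    exact ⟨rfl, hLip.tendsto_infEDist_criticalSet hreg hmax.1 hC hxC⟩
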